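/- Let $S=\{(1,0),(-1,0),(0,1),(0,-1)\}$. A sequence of instructions is an infinite nearest-neighbour walk $x=(x_t)_{t\ge 0}$ in $\mathbb{Z}^2$, i.e. $x_0=0$ and $x_{t+1}-x_t\in S$ for all $t\ge 0$. For $p\in[0,1]$, the guided random walk with instructions $x$ and error probability $p$ is the Markov chain $(X_t)_{t\ge 0}$ in $\mathbb{Z}^2$ with $X_0=0$ in which, independently of the past, $X_{t+1}-X_t$ equals $x_{t+1}-x_t$ with probability $1-p$ and is uniformly distributed on $S$ with probability $p$. For $x_{\mathrm{home}}\in\mathbb{Z}^2$ let $T:=\inf\{t\ge 0 : X_t=x_{\mathrm{home}}\}\in\{0,1,2,\dots\}\cup\{\infty\}$. For a positive integer $\tau$ let $$R_\tau(p):=\min_{x}\ \mathbb{E}\bigl[\#\{t\in\{0,1,\dots,\tau\} : X_t=0\}\bigr],$$ where the minimum is over all sequences of instructions $x$ (time $0$ is counted, so $R_\tau(p)\ge 1$). Proposition. Let $0<p\le 1$ and $x_{\mathrm{home}}\in\mathbb{Z}^2\setminus\{0\}$, and suppose that there is a sequence of instructions such that $\mathbb{E}[T]<\infty$. Then, for every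 positive integer $\tau$, $$1\le \frac{4}{\pi\, p\,\sqrt{3-2p}\;R_\tau(p)}.$$ -/

import Mathlib

open MeasureTheory
open scoped ENNReal

noncomputable section

namespace GuidedWalk

/-- The four unit steps of the square grid. -/
def unitSteps : Finset (ℤ × ℤ) := {(1, 0), (-1, 0), (0, 1), (0, -1)}

/-- A sequence of instructions: an infinite nearest-neighbour walk in `ℤ²` started at `0`. -/
structure Instructions where
  /-- the position prescribed at each time -/
  pos : ℕ → ℤ × ℤ
  pos_zero : pos 0 = 0
  step_mem : ∀ t, pos (t + 1) - pos t ∈ unitSteps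

/-- The instructed increment between times `t` and `t + 1`. -/
def Instructions.step (x : Instructions) (t : ℕ) : ℤ × ℤ := x.pos (t + 1) - x.pos t

/-- The law of one increment of the walk when the instructed increment is `v`: equal to `v` with
probability `1 - p`, and uniform on the four unit steps with probability `p`. -/
def stepLaw (p : unitInterval) (v : ℤ × ℤ) : Measure (ℤ × ℤ) :=
  ENNReal.ofReal (1 - p) • Measure.dirac v +
    ∑ u ∈ unitSteps, ENNReal.ofReal (p / 4) • Measure.dirac u

instance stepLaw_isProbabilityMeasure (p : unitInterval) (v : ℤ × ℤ) :
    IsProbabilityMeasure (stepLaw p v) := by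
  constructor
  have h0 : (0 : ℝ) ≤ (p : ℝ) / 4 := div_nonneg p.2.1 (by norm_num)
  have h1 : (0 : ℝ) ≤ 1 - (p : ℝ) := sub_nonneg.2 p.2.2
  have hc : unitSteps.card = 4 := by decide
  simp only [stepLaw, Measure.coe_add, Measure.coe_smul, Measure.coe_finsetSum, Pi.add_apply,
    Pi.smul_apply, Finset.sum_apply, measure_univ, smul_eq_mul, mul_one, Finset.sum_const, hc]
  rw [← ENNReal.ofReal_nsmul, ← ENNReal.ofReal_add h1 (by positivity), ← ENNReal.ofReal_one]
  congr 1
  simp only [nsmul_eq_mul]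
  push_cast
  ring

/-- The joint law of the increments of the guided random walk: the increments are independent
(the increment at time `t` has law `stepLaw p (x.step t)` whatever the past), so this is the
product measure on the space of increment sequences. -/
def law (p : unitInterval) (x : Instructions) : Measure (ℕ → ℤ × ℤ) :=
  Measure.infinitePi fun t => stepLaw p (x.step t)

/-- The position `X_t` of the walk started at `0`, as a function of the increments. Under
`law p x` the process `walk` is the guided random walk with instructions `x` and error
probability `p`. -/
def walk (t : ℕ) (ω : ℕ → ℤ × ℤ) : ℤ × ℤ := ∑ i ∈ Finset.range t, ω i

/-- The hitting time `T = inf {t : X_t = home}`, equal to `∞` if `home` is never visited. -/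
def hittingTime (home : ℤ × ℤ) (ω : ℕ → ℤ × ℤ) : ℝ≥0∞ :=
  ⨅ (t : ℕ) (_ : walk t ω = home), (t : ℝ≥0∞)

/-- The expected hitting time `𝔼[T]`, possibly infinite. -/
def expectedHittingTime (p : unitInterval) (x : Instructions) (home : ℤ × ℤ) : ℝ≥0∞ :=
  ∫⁻ ω, hittingTime home ω ∂(law p x)

/-- The number of times `t ∈ {0, 1, …, τ}` (time `0` included) at which the walk is at `0`. -/
def visits (τ : ℕ) (ω : ℕ → ℤ × ℤ) : ℕ :=
  ((Finset.range (τ + 1)).filter fun t => walk t ω = 0).card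

/-- `R_τ(p)`: the least expected number of visits to the starting point during `{0, …, τ}`,
over all sequences of instructions. (The expectation depends only on the first `τ`
instructions, so the infimum is attained.) -/
def minReturns (τ : ℕ) (p : unitInterval) : ℝ :=
  ⨅ x : Instructions, ∫ ω, (visits τ ω : ℝ) ∂(law p x)

end GuidedWalk

end

/-!
*Point probabilities.* By Fourier inversion on `ℤ²` the probability that the walk is at a given
point at time `n` is at most the average over the torus of the product of the moduli of the
characteristic functions of the `n` increments. These moduli depend on the instructions only up to
swapping the coordinates, so by the inequality of arithmetic and geometric means the constant
instruction `(1, 0)` is the worst case, and Laplace's method at the two frequencies `0` and `(π, π)`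
of modulus one bounds the probability asymptotically by `D / n`, with `D = 2 / (π p √(3 - 2p))`,
uniformly in the instructions and in the point.

*Renewal.* Let `R = R_τ(p)`. Each first visit to the home at a time `r > τ` is followed by `R`
expected visits at times `t` with `r ≤ t < 2 r`, so `R 𝔼[T]` is at most `R τ` plus the expectation
of the sum of the times `t` at which the walk is at home without having been there up to time
`t / 2`. By the previous bound and parity, that expectation is for every `D' > D` at most
`2 D' 𝔼[T] + C`, where `C` depends neither on the instructions nor on the home.

*Conclusion.* With positive probability errors carry the walk arbitrarily far away from the home.
Hence, as the instructions and the home vary, `𝔼[T]` takes arbitrarily large finite values, and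
`R ≤ 2 D`.
-/

namespace GuidedWalk

open ProbabilityTheory Filter Set

section Restart

lemma indepFun_domRestrict_infinitePi {ι : Type*} {Ω : ι → Type*} [∀ i, MeasurableSpace (Ω i)]
    (μ : ∀ i, Measure (Ω i)) [∀ i, IsProbabilityMeasure (μ i)] {S T : Set ι}
    (hST : Disjoint S T) :
    IndepFun S.domRestrict T.domRestrict (Measure.infinitePi μ) := by
  have hind : iIndep (fun i => MeasurableSpace.comap (fun ω : ∀ i, Ω i => ω i) inferInstance)
      (Measure.infinitePi μ) :=
    (iIndepFun_infinitePi (X := fun _ ω => ω) fun _ => measurable_id).iIndep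
  have hle (U : Set ι) :
      MeasurableSpace.comap (U.domRestrict (π := Ω)) inferInstance ≤
        ⨆ i ∈ U, MeasurableSpace.comap (fun ω : ∀ i, Ω i => ω i) inferInstance := by
    rw [MeasurableSpace.pi, MeasurableSpace.comap_iSup]
    refine iSup_le fun i => ?_
    rw [MeasurableSpace.comap_comp]
    exact le_iSup₂_of_le (i : ι) i.2 le_rfl
  exact (IndepFun_iff_Indep _ _ _).2 <| indep_of_indep_of_le_left (indep_of_indep_of_le_right
    (indep_iSup_of_disjoint (fun i => (measurable_pi_apply i).comap_le) hind hST) (hle T)) (hle S)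

/-- The sequence `ω` from time `k` on. -/
def drop {E : Type*} (k : ℕ) (ω : ℕ → E) : ℕ → E := fun i => ω (i + k)

variable {E : Type*} [MeasurableSpace E] {k : ℕ}

lemma measurable_drop (k : ℕ) : Measurable (drop (E := E) k) := by
  unfold drop; fun_prop

lemma exists_preimage_domRestrict_eq [Countable E] [MeasurableSingletonClass E]
    {A : Set (ℕ → E)} (hA : DependsOn (· ∈ A) (Iio k)) :
    ∃ B : Set (Iio k → E), MeasurableSet B ∧ (Iio k).domRestrict ⁻¹' B = A := by
  obtain ⟨B, hB⟩ := dependsOn_iff_exists_comp.1 hA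
  exact ⟨B, MeasurableSet.of_discrete, hB.symm⟩

lemma measurableSet_of_dependsOn [Countable E] [MeasurableSingletonClass E]
    {A : Set (ℕ → E)} (hA : DependsOn (· ∈ A) (Iio k)) : MeasurableSet A := by
  obtain ⟨B, hB, rfl⟩ := exists_preimage_domRestrict_eq hA
  exact measurable_restrict _ hB

lemma map_drop_infinitePi (μ : ℕ → Measure E) [∀ i, IsProbabilityMeasure (μ i)] (k : ℕ) :
    (Measure.infinitePi μ).map (drop k) = Measure.infinitePi fun i => μ (i + k) :=
  Measure.map_infinitePi_infinitePi_of_inj (f := (· + k)) (add_left_injective k)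

theorem setLIntegral_comp_drop (μ : ℕ → Measure E) [∀ i, IsProbabilityMeasure (μ i)]
    {B : Set (Iio k → E)} (hB : MeasurableSet B) {F : (ℕ → E) → ℝ≥0∞} (hF : Measurable F) :
    ∫⁻ ω in (Iio k).domRestrict ⁻¹' B, F (drop k ω) ∂Measure.infinitePi μ =
      Measure.infinitePi μ ((Iio k).domRestrict ⁻¹' B) *
        ∫⁻ ω, F ω ∂Measure.infinitePi fun i => μ (i + k) := by
  have hB₁ : Measurable (B.indicator (1 : (Iio k → E) → ℝ≥0∞)) := measurable_one.indicator hB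
  have hpast : Measurable ((Iio k).domRestrict (π := fun _ : ℕ => E)) := measurable_restrict _
  let future (f : Ici k → E) : ℕ → E := fun i => f ⟨i + k, Nat.le_add_left k i⟩
  have hfuture : Measurable future := by fun_prop
  have hind : IndepFun (B.indicator 1 ∘ (Iio k).domRestrict) (F ∘ drop k)
      (Measure.infinitePi μ) :=
    (indepFun_domRestrict_infinitePi μ (Iio_disjoint_Ici le_rfl)).comp hB₁ (hF.comp hfuture)
  rw [← lintegral_indicator (hpast hB), ← lintegral_indicator_one (hpast hB),
    ← map_drop_infinitePi, lintegral_map hF (measurable_drop k)]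
  refine Eq.trans (lintegral_congr fun ω => ?_)
    (lintegral_mul_eq_lintegral_mul_lintegral_of_indepFun (hB₁.comp hpast)
      (hF.comp (measurable_drop k)) hind)
  by_cases hω : (Iio k).domRestrict ω ∈ B <;> simp [hω]

end Restart

section Walk

/-- The instructions that remain after the first `k` of them. -/
def Instructions.shift (x : Instructions) (k : ℕ) : Instructions where
  pos n := x.pos (n + k) - x.pos k
  pos_zero := by simp
  step_mem n := by simpa [add_right_comm] using x.step_mem (n + k)

lemma Instructions.step_shift (x : Instructions) (k n : ℕ) :
    (x.shift k).step n = x.step (n + k) := by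
  simp [Instructions.step, Instructions.shift, add_right_comm]

instance law_isProbabilityMeasure (p : unitInterval) (x : Instructions) :
    IsProbabilityMeasure (law p x) := by
  unfold law; infer_instance

variable {v : ℤ × ℤ} {k : ℕ} {ω : ℕ → ℤ × ℤ}

theorem setLIntegral_comp_drop_law (p : unitInterval) (x : Instructions)
    {A : Set (ℕ → ℤ × ℤ)} (hA : DependsOn (· ∈ A) (Iio k)) {F : (ℕ → ℤ × ℤ) → ℝ≥0∞}
    (hF : Measurable F) :
    ∫⁻ ω in A, F (drop k ω) ∂law p x = law p x A * ∫⁻ ω, F ω ∂law p (x.shift k) := by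
  obtain ⟨B, hB, rfl⟩ := exists_preimage_domRestrict_eq hA
  simp only [law, Instructions.step_shift]
  exact setLIntegral_comp_drop _ hB hF

theorem law_inter_preimage_drop (p : unitInterval) (x : Instructions) {A B : Set (ℕ → ℤ × ℤ)}
    (hA : DependsOn (· ∈ A) (Iio k)) (hB : MeasurableSet B) :
    law p x (A ∩ drop k ⁻¹' B) = law p x A * law p (x.shift k) B := by
  have hdrop : MeasurableSet (drop k ⁻¹' B) := measurable_drop k hB
  rw [← lintegral_indicator_one hB,
    ← setLIntegral_comp_drop_law p x hA (measurable_one.indicator hB), inter_comm,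
    ← Measure.restrict_apply hdrop, ← lintegral_indicator_one hdrop]
  rfl

lemma walk_zero (ω : ℕ → ℤ × ℤ) : walk 0 ω = 0 := rfl

lemma walk_succ (t : ℕ) (ω : ℕ → ℤ × ℤ) : walk (t + 1) ω = walk t ω + ω t :=
  Finset.sum_range_succ _ _

lemma walk_add (s m : ℕ) (ω : ℕ → ℤ × ℤ) : walk (s + m) ω = walk s ω + walk m (drop s ω) := by
  simp only [walk, drop, Finset.sum_range_add, add_comm]

lemma measurable_walk (t : ℕ) : Measurable (walk t) := by
  unfold walk; fun_prop

lemma measurableSet_walk_eq (t : ℕ) (v : ℤ × ℤ) : MeasurableSet {ω | walk t ω = v} :=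
  measurable_walk t (measurableSet_singleton v)

lemma dependsOn_walk {j : ℕ} (hj : j ≤ k) : DependsOn (walk j) (Iio k) :=
  fun _ _ h => Finset.sum_congr rfl fun i hi => h i ((Finset.mem_range.1 hi).trans_le hj)

lemma ae_mem_unitSteps_stepLaw (p : unitInterval) (hv : v ∈ unitSteps) :
    ∀ᵐ u ∂stepLaw p v, u ∈ unitSteps := by
  rw [stepLaw, ae_add_measure_iff, ← Measure.sum_coe_finset, Measure.ae_sum_iff]
  exact ⟨Measure.ae_smul_measure (by simpa [ae_dirac_eq]) _,
    fun u => Measure.ae_smul_measure (by simp [ae_dirac_eq]) _⟩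

lemma ae_mem_unitSteps_law (p : unitInterval) (x : Instructions) :
    ∀ᵐ ω ∂law p x, ∀ i, ω i ∈ unitSteps :=
  ae_all_iff.2 fun i => (measurePreserving_eval_infinitePi _ i).quasiMeasurePreserving.ae
    (ae_mem_unitSteps_stepLaw p (x.step_mem i))

lemma norm_of_mem_unitSteps (hv : v ∈ unitSteps) : ‖v‖ = 1 := by
  simp only [unitSteps, Finset.mem_insert, Finset.mem_singleton] at hv
  rcases hv with rfl | rfl | rfl | rfl <;> simp [Prod.norm_def]

lemma norm_walk_le (hω : ∀ i, ω i ∈ unitSteps) (t : ℕ) : ‖walk t ω‖ ≤ t :=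
  (norm_sum_le_of_le _ fun i _ => (norm_of_mem_unitSteps (hω i)).le).trans (by simp)

lemma even_walk_sub_time (hω : ∀ i, ω i ∈ unitSteps) (t : ℕ) :
    Even ((walk t ω).1 + (walk t ω).2 - t) := by
  induction t with
  | zero => simp [walk_zero]
  | succ t ih =>
    have hstep := hω t
    simp only [unitSteps, Finset.mem_insert, Finset.mem_singleton] at hstep
    rw [walk_succ]
    rcases hstep with h | h | h | h <;> rw [h] <;> simp <;> grind

lemma law_walk_eq_zero_of_not_even (p : unitInterval) (x : Instructions) {t : ℕ}
    (h : ¬ Even (v.1 + v.2 - (t : ℤ))) : law p x {ω | walk t ω = v} = 0 := by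
  refine measure_mono_null ?_ (ae_iff.1 (ae_mem_unitSteps_law p x))
  rintro ω rfl hω
  exact h (even_walk_sub_time hω t)

theorem law_inter_walk_add_eq_le (p : unitInterval) (x : Instructions) (v : ℤ × ℤ)
    {A : Set (ℕ → ℤ × ℤ)} (hA : DependsOn (· ∈ A) (Iio k)) (m : ℕ) :
    law p x (A ∩ {ω | walk (k + m) ω = v}) ≤
      law p x A * ⨆ w, law p (x.shift k) {ω | walk m ω = w} := by
  have hAz (z : ℤ × ℤ) : DependsOn (· ∈ A ∩ {ω | walk k ω = z}) (Iio k) := fun _ _ h => by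
    simp only [mem_inter_iff, mem_ofPred_eq, hA h, dependsOn_walk le_rfl h]
  have hunion : A = ⋃ z, A ∩ {ω | walk k ω = z} := by ext; simp
  have hsub : A ∩ {ω | walk (k + m) ω = v} ⊆
      ⋃ z, (A ∩ {ω | walk k ω = z}) ∩ drop k ⁻¹' {ω | walk m ω = v - z} := by
    rintro ω ⟨hω, rfl⟩
    exact mem_iUnion.2 ⟨walk k ω, ⟨hω, rfl⟩, by simp [walk_add]⟩
  calc law p x (A ∩ {ω | walk (k + m) ω = v})
      ≤ ∑' z, law p x ((A ∩ {ω | walk k ω = z}) ∩ drop k ⁻¹' {ω | walk m ω = v - z}) :=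
        (measure_mono hsub).trans (measure_iUnion_le _)
    _ = ∑' z, law p x (A ∩ {ω | walk k ω = z}) * law p (x.shift k) {ω | walk m ω = v - z} :=
        tsum_congr fun z => law_inter_preimage_drop p x (hAz z) (measurableSet_walk_eq m _)
    _ ≤ ∑' z, law p x (A ∩ {ω | walk k ω = z}) * ⨆ w, law p (x.shift k) {ω | walk m ω = w} := by
        gcongr with z
        exact le_iSup (fun w => law p (x.shift k) {ω | walk m ω = w}) (v - z)
    _ = law p x A * ⨆ w, law p (x.shift k) {ω | walk m ω = w} := by
        rw [ENNReal.tsum_mul_right, ← measure_iUnion _ fun z => measurableSet_of_dependsOn (hAz z),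
          ← hunion]
        exact fun a b hab => disjoint_left.2 fun ω ha hb => hab (ha.2.symm.trans hb.2)

end Walk

section Fourier

open Real

/-- The character `w ↦ exp (i ⟨w, θ⟩)` of `ℤ²` with frequency `θ`. -/
noncomputable def character (θ : ℝ × ℝ) : AddChar (ℤ × ℤ) ℂ where
  toFun w := Complex.exp ((w.1 * θ.1 + w.2 * θ.2 : ℝ) * Complex.I)
  map_zero_eq_one' := by simp
  map_add_eq_mul' v w := by
    rw [← Complex.exp_add]
    congr 1
    push_cast [Prod.fst_add, Prod.snd_add]
    ring

lemma character_apply (θ : ℝ × ℝ) (w : ℤ × ℤ) :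
    character θ w = Complex.exp ((w.1 * θ.1 + w.2 * θ.2 : ℝ) * Complex.I) := rfl

@[simp] lemma norm_character (θ : ℝ × ℝ) (w : ℤ × ℤ) : ‖character θ w‖ = 1 :=
  Complex.norm_exp_ofReal_mul_I _

lemma continuous_character : Continuous fun q : (ℝ × ℝ) × (ℤ × ℤ) => character q.1 q.2 := by
  simp only [character_apply]
  fun_prop

/-- A fundamental domain of the torus `(ℝ / 2πℤ)²` with `0` and `(π, π)` in its interior: at these
two frequencies the characteristic functions of the increments have modulus one. -/
def box : Set (ℝ × ℝ) := Ioc (-(π / 2)) (3 * π / 2) ×ˢ Ioc (-(π / 2)) (3 * π / 2)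

lemma box_subset_Icc : box ⊆ Icc (-(π / 2), -(π / 2)) (3 * π / 2, 3 * π / 2) := by
  rw [← Icc_prod_Icc]
  exact prod_mono Ioc_subset_Icc_self Ioc_subset_Icc_self

lemma measurableSet_box : MeasurableSet box := measurableSet_Ioc.prod measurableSet_Ioc

lemma volume_box_lt_top : volume box < ⊤ :=
  (measure_mono box_subset_Icc).trans_lt isCompact_Icc.measure_lt_top

lemma integrableOn_box {E : Type*} [NormedAddCommGroup E] {f : ℝ × ℝ → E} (hf : Continuous f) :
    IntegrableOn f box :=
  (hf.continuousOn.integrableOn_compact isCompact_Icc).mono_set box_subset_Icc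

lemma integral_box_swap {E : Type*} [NormedAddCommGroup E] [NormedSpace ℝ E] (f : ℝ × ℝ → E) :
    ∫ θ in box, f θ.swap = ∫ θ in box, f θ := by
  unfold box
  rw [Measure.volume_eq_prod]
  exact setIntegral_prod_swap _ _ f

lemma integral_exp_int_mul (k : ℤ) :
    ∫ t in Ioc (-(π / 2)) (3 * π / 2), Complex.exp (k * Complex.I * t) =
      if k = 0 then 2 * (π : ℂ) else 0 := by
  rw [← intervalIntegral.integral_of_le (by linarith [pi_pos])]
  split_ifs with hk
  · simp only [hk, Int.cast_zero, zero_mul, Complex.exp_zero, intervalIntegral.integral_const,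
      Complex.real_smul, mul_one]
    push_cast
    ring
  · have hperiod : (k : ℂ) * Complex.I * ((3 * π / 2 : ℝ) : ℂ) =
        (k : ℂ) * Complex.I * ((-(π / 2) : ℝ) : ℂ) + k * (2 * π * Complex.I) := by
      push_cast; ring
    rw [integral_exp_mul_complex (by simp [hk]), hperiod, Complex.exp_add,
      Complex.exp_int_mul_two_pi_mul_I, mul_one, sub_self, zero_div]

lemma integral_character (w : ℤ × ℤ) :
    ∫ θ in box, character θ w = if w = 0 then 4 * (π : ℂ) ^ 2 else 0 := by
  have hprod (θ : ℝ × ℝ) : character θ w =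
      Complex.exp (w.1 * Complex.I * θ.1) * Complex.exp (w.2 * Complex.I * θ.2) := by
    rw [character_apply, ← Complex.exp_add]
    congr 1
    push_cast
    ring
  simp only [hprod, box]
  rw [Measure.volume_eq_prod, setIntegral_prod_mul (fun a : ℝ => Complex.exp (w.1 * Complex.I * a))
    (fun b : ℝ => Complex.exp (w.2 * Complex.I * b)), integral_exp_int_mul, integral_exp_int_mul]
  rcases w with ⟨a, b⟩
  by_cases ha : a = 0 <;> by_cases hb : b = 0 <;> simp [ha, hb]
  ring

/-- The characteristic function `θ ↦ ∫ exp (i ⟨w, θ⟩) dμ(w)` of a measure on `ℤ²`. -/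
noncomputable def latticeCharFun (μ : Measure (ℤ × ℤ)) (θ : ℝ × ℝ) : ℂ :=
  ∫ w, character θ w ∂μ

section Inversion

variable (μ : Measure (ℤ × ℤ)) [IsFiniteMeasure μ]

lemma integrable_character (θ : ℝ × ℝ) : Integrable (fun w => character θ w) μ :=
  .of_bound (C := 1) (by fun_prop) (by simp)

lemma continuous_latticeCharFun : Continuous (latticeCharFun μ) :=
  continuous_of_dominated (bound := fun _ => 1) (fun θ => (integrable_character μ θ).1)
    (fun θ => by simp) (integrable_const 1)
    (.of_forall fun w => continuous_character.comp (.prodMk_left w))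

theorem integral_latticeCharFun_mul_character (w : ℤ × ℤ) :
    ∫ θ in box, latticeCharFun μ θ * character θ (-w) = 4 * π ^ 2 * μ.real {w} := by
  have : IsFiniteMeasure (volume.restrict box) := ⟨by simpa using volume_box_lt_top⟩
  have hcont : Continuous fun q : (ℝ × ℝ) × (ℤ × ℤ) => character q.1 (q.2 - w) := by
    simp only [character_apply]
    fun_prop
  have hint : Integrable (fun q : (ℝ × ℝ) × (ℤ × ℤ) => character q.1 (q.2 - w))
      ((volume.restrict box).prod μ) :=
    .of_bound (C := 1) hcont.aestronglyMeasurable (by simp)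
  calc ∫ θ in box, latticeCharFun μ θ * character θ (-w)
      = ∫ θ in box, ∫ v, character θ (v - w) ∂μ := by
        simp_rw [latticeCharFun, ← integral_mul_const, sub_eq_add_neg, AddChar.map_add_eq_mul]
    _ = ∫ v, (∫ θ in box, character θ (v - w)) ∂μ := integral_integral_swap hint
    _ = ∫ v, ({w} : Set (ℤ × ℤ)).indicator (fun _ => 4 * (π : ℂ) ^ 2) v ∂μ := by
        simp only [integral_character, sub_eq_zero, indicator_apply, mem_singleton_iff]
    _ = 4 * π ^ 2 * μ.real {w} := by
        rw [integral_indicator_const _ (measurableSet_singleton w), Complex.real_smul, mul_comm]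

theorem real_singleton_le_integral_norm_latticeCharFun (w : ℤ × ℤ) :
    4 * π ^ 2 * μ.real {w} ≤ ∫ θ in box, ‖latticeCharFun μ θ‖ := by
  calc 4 * π ^ 2 * μ.real {w} = ‖∫ θ in box, latticeCharFun μ θ * character θ (-w)‖ := by
        rw [integral_latticeCharFun_mul_character]
        norm_cast
        exact (Real.norm_of_nonneg (by positivity)).symm
    _ ≤ ∫ θ in box, ‖latticeCharFun μ θ * character θ (-w)‖ := norm_integral_le_integral_norm _
    _ = ∫ θ in box, ‖latticeCharFun μ θ‖ := by simp

end Inversion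

lemma character_walk (θ : ℝ × ℝ) (n : ℕ) (ω : ℕ → ℤ × ℤ) :
    character θ (walk n ω) = ∏ i ∈ Finset.range n, character θ (ω i) := by
  induction n with
  | zero => simp [walk_zero]
  | succ n ih => rw [walk_succ, AddChar.map_add_eq_mul, ih, Finset.prod_range_succ]

theorem latticeCharFun_map_walk (μ : ℕ → Measure (ℤ × ℤ)) [∀ i, IsProbabilityMeasure (μ i)]
    (n : ℕ) (θ : ℝ × ℝ) :
    latticeCharFun ((Measure.infinitePi μ).map (walk n)) θ =
      ∏ i ∈ Finset.range n, latticeCharFun (μ i) θ := by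
  have hind : iIndepFun (fun (i : Fin n) (ω : ℕ → ℤ × ℤ) => ω i) (Measure.infinitePi μ) :=
    (iIndepFun_infinitePi (X := fun _ ω => ω) fun _ => measurable_id).precomp Fin.val_injective
  have heval (i : ℕ) : ∫ ω, character θ (ω i) ∂Measure.infinitePi μ = latticeCharFun (μ i) θ := by
    rw [latticeCharFun, ← Measure.infinitePi_map_eval μ i,
      integral_map (measurable_pi_apply i).aemeasurable (by fun_prop)]
  rw [latticeCharFun, integral_map (measurable_walk n).aemeasurable (by fun_prop)]
  simp only [character_walk, Finset.prod_range, ← heval]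
  exact hind.integral_fun_prod_comp (f := fun _ => character θ)
    (fun i => (measurable_pi_apply (i : ℕ)).aemeasurable) fun i => by fun_prop


section StepCharFun

lemma latticeCharFun_stepLaw (p : unitInterval) (v : ℤ × ℤ) (θ : ℝ × ℝ) :
    latticeCharFun (stepLaw p v) θ =
      (1 - p : ℝ) * character θ v + (p * (cos θ.1 + cos θ.2) / 2 : ℝ) := by
  have h0 : (0 : ℝ) ≤ p / 4 := div_nonneg p.2.1 (by norm_num)
  have h1 : (0 : ℝ) ≤ 1 - p := sub_nonneg.2 p.2.2
  have hdirac (u : ℤ × ℤ) : Integrable (fun w => character θ w) (Measure.dirac u) :=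
    integrable_character _ θ
  rw [latticeCharFun, stepLaw, integral_add_measure ((hdirac v).smul_measure ENNReal.ofReal_ne_top)
    (integrable_finsetSum_measure.2 fun u _ => (hdirac u).smul_measure ENNReal.ofReal_ne_top),
    integral_finsetSum_measure fun u _ => (hdirac u).smul_measure ENNReal.ofReal_ne_top]
  simp only [integral_smul_measure, integral_dirac, ENNReal.toReal_ofReal h0,
    ENNReal.toReal_ofReal h1, Complex.real_smul, unitSteps]
  simp [character_apply, Complex.ext_iff, Complex.exp_re, Complex.exp_im, -Complex.ofReal_cos]
  ring

lemma sq_norm_ofReal_mul_exp_add_ofReal (a b t : ℝ) :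
    ‖(a : ℂ) * Complex.exp (t * Complex.I) + b‖ ^ 2 = a ^ 2 + 2 * a * b * cos t + b ^ 2 := by
  rw [Complex.sq_norm, Complex.normSq_apply]
  simp only [Complex.add_re, Complex.add_im, Complex.re_ofReal_mul, Complex.im_ofReal_mul,
    Complex.exp_ofReal_mul_I_re, Complex.exp_ofReal_mul_I_im, Complex.ofReal_re, Complex.ofReal_im]
  linear_combination a ^ 2 * Real.sin_sq_add_cos_sq t

/-- The modulus of the characteristic function of an increment whose instruction is horizontal. -/
noncomputable def stepCharNorm (p : unitInterval) (θ : ℝ × ℝ) : ℝ :=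
  ‖latticeCharFun (stepLaw p (1, 0)) θ‖

lemma continuous_stepCharNorm (p : unitInterval) : Continuous (stepCharNorm p) :=
  (continuous_latticeCharFun _).norm

lemma stepCharNorm_nonneg (p : unitInterval) (θ : ℝ × ℝ) : 0 ≤ stepCharNorm p θ := norm_nonneg _

lemma sq_norm_latticeCharFun_stepLaw (p : unitInterval) (v : ℤ × ℤ) (θ : ℝ × ℝ) :
    ‖latticeCharFun (stepLaw p v) θ‖ ^ 2 = (1 - p : ℝ) ^ 2 +
      p * (1 - p) * cos (v.1 * θ.1 + v.2 * θ.2) * (cos θ.1 + cos θ.2) +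
      p ^ 2 / 4 * (cos θ.1 + cos θ.2) ^ 2 := by
  rw [latticeCharFun_stepLaw, character_apply, sq_norm_ofReal_mul_exp_add_ofReal]
  ring

lemma sq_stepCharNorm (p : unitInterval) (θ : ℝ × ℝ) :
    stepCharNorm p θ ^ 2 = (1 - p : ℝ) ^ 2 + p * (1 - p) * cos θ.1 * (cos θ.1 + cos θ.2) +
      p ^ 2 / 4 * (cos θ.1 + cos θ.2) ^ 2 := by
  simp [stepCharNorm, sq_norm_latticeCharFun_stepLaw]

lemma norm_latticeCharFun_stepLaw (p : unitInterval) {v : ℤ × ℤ} (hv : v ∈ unitSteps) :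
    (∀ θ, ‖latticeCharFun (stepLaw p v) θ‖ = stepCharNorm p θ) ∨
      ∀ θ, ‖latticeCharFun (stepLaw p v) θ‖ = stepCharNorm p θ.swap := by
  simp only [← sq_eq_sq₀ (norm_nonneg _) (stepCharNorm_nonneg _ _),
    sq_norm_latticeCharFun_stepLaw, sq_stepCharNorm, Prod.fst_swap, Prod.snd_swap]
  simp only [unitSteps, Finset.mem_insert, Finset.mem_singleton] at hv
  rcases hv with rfl | rfl | rfl | rfl
  · left; simp
  · left; simp
  · right; simp [add_comm]
  · right; simp [add_comm]

lemma integral_norm_latticeCharFun_stepLaw_pow (p : unitInterval) {v : ℤ × ℤ}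
    (hv : v ∈ unitSteps) (n : ℕ) :
    ∫ θ in box, ‖latticeCharFun (stepLaw p v) θ‖ ^ n = ∫ θ in box, stepCharNorm p θ ^ n := by
  rcases norm_latticeCharFun_stepLaw p hv with h | h <;> simp only [h]
  exact integral_box_swap fun θ => stepCharNorm p θ ^ n

lemma prod_le_sum_inv_card_mul_pow {ι : Type*} {s : Finset ι} (hs : s.Nonempty) {z : ι → ℝ}
    (hz : ∀ i ∈ s, 0 ≤ z i) : ∏ i ∈ s, z i ≤ ∑ i ∈ s, (s.card : ℝ)⁻¹ * z i ^ s.card := by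
  have hcard : s.card ≠ 0 := hs.card_pos.ne'
  calc ∏ i ∈ s, z i = ∏ i ∈ s, (z i ^ s.card) ^ (s.card : ℝ)⁻¹ :=
        Finset.prod_congr rfl fun i hi => (Real.pow_rpow_inv_natCast (hz i hi) hcard).symm
    _ ≤ _ := Real.geom_mean_le_arith_mean_weighted s _ _ (fun _ _ => by positivity)
        (by simp [hcard]) fun i hi => pow_nonneg (hz i hi) _

/-- By the inequality of arithmetic and geometric means; it spares Hölder's inequality. -/
lemma integral_prod_le_of_integral_pow_le {α ι : Type*} [MeasurableSpace α] {μ : Measure α}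
    {s : Finset ι} (hs : s.Nonempty) {f : ι → α → ℝ} (hf : ∀ i ∈ s, ∀ a, 0 ≤ f i a)
    (hint : ∀ i ∈ s, Integrable (fun a => f i a ^ s.card) μ) {C : ℝ}
    (hC : ∀ i ∈ s, ∫ a, f i a ^ s.card ∂μ ≤ C) : ∫ a, ∏ i ∈ s, f i a ∂μ ≤ C := by
  have hint' (i) (hi : i ∈ s) := (hint i hi).const_mul (s.card : ℝ)⁻¹
  calc ∫ a, ∏ i ∈ s, f i a ∂μ
      ≤ ∫ a, ∑ i ∈ s, (s.card : ℝ)⁻¹ * f i a ^ s.card ∂μ :=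
        integral_mono_of_nonneg (.of_forall fun a => Finset.prod_nonneg fun i hi => hf i hi a)
          (integrable_finsetSum _ hint')
          (.of_forall fun a => prod_le_sum_inv_card_mul_pow hs fun i hi => hf i hi a)
    _ = ∑ i ∈ s, (s.card : ℝ)⁻¹ * ∫ a, f i a ^ s.card ∂μ := by
        simp only [integral_finsetSum _ hint', integral_const_mul]
    _ ≤ ∑ _i ∈ s, (s.card : ℝ)⁻¹ * C :=
        Finset.sum_le_sum fun i hi => mul_le_mul_of_nonneg_left (hC i hi) (by positivity)
    _ = C := by
        rw [Finset.sum_const, nsmul_eq_mul, mul_inv_cancel_left₀]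
        exact Nat.cast_ne_zero.2 hs.card_pos.ne'

theorem law_walk_eq_le_integral_stepCharNorm_pow (p : unitInterval) (x : Instructions) {n : ℕ}
    (hn : n ≠ 0) (w : ℤ × ℤ) :
    4 * π ^ 2 * (law p x).real {ω | walk n ω = w} ≤ ∫ θ in box, stepCharNorm p θ ^ n := by
  have : IsProbabilityMeasure ((law p x).map (walk n)) :=
    Measure.isProbabilityMeasure_map (measurable_walk n).aemeasurable
  calc 4 * π ^ 2 * (law p x).real {ω | walk n ω = w}
      = 4 * π ^ 2 * ((law p x).map (walk n)).real {w} := by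
        rw [map_measureReal_apply (measurable_walk n) (measurableSet_singleton w)]
        rfl
    _ ≤ ∫ θ in box, ‖latticeCharFun ((law p x).map (walk n)) θ‖ :=
        real_singleton_le_integral_norm_latticeCharFun _ w
    _ = ∫ θ in box, ∏ i ∈ Finset.range n, ‖latticeCharFun (stepLaw p (x.step i)) θ‖ := by
        simp only [law, latticeCharFun_map_walk, norm_prod]
    _ ≤ ∫ θ in box, stepCharNorm p θ ^ n := by
        refine integral_prod_le_of_integral_pow_le (Finset.nonempty_range_iff.2 hn)
          (fun i _ θ => norm_nonneg _) (fun i _ => ?_) fun i _ => ?_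
        · exact integrableOn_box ((continuous_latticeCharFun _).norm.pow _)
        · rw [Finset.card_range]
          exact (integral_norm_latticeCharFun_stepLaw_pow p (x.step_mem i) n).le

end StepCharFun

section LocalBound

variable {p : unitInterval} {κ ε : ℝ} {θ : ℝ × ℝ}

lemma sq_stepCharNorm_le (hε : (1 - cos θ.1) + (1 - cos θ.2) ≤ ε) :
    stepCharNorm p θ ^ 2 ≤
      1 - (1 - ε) * (p * (3 - 2 * p) * (1 - cos θ.1) + p * (1 - cos θ.2)) := by
  have hp0 : (0 : ℝ) ≤ p := p.2.1
  have hp1 : (0 : ℝ) ≤ 1 - p := sub_nonneg.2 p.2.2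
  have ha : 0 ≤ 1 - cos θ.1 := sub_nonneg.2 (cos_le_one _)
  have hb : 0 ≤ 1 - cos θ.2 := sub_nonneg.2 (cos_le_one _)
  have hexpand : stepCharNorm p θ ^ 2 =
      1 - (p * (3 - 2 * p) * (1 - cos θ.1) + p * (1 - cos θ.2)) +
      ((1 - cos θ.1) + (1 - cos θ.2)) *
        (p * (1 - p) * (1 - cos θ.1) + p ^ 2 / 4 * ((1 - cos θ.1) + (1 - cos θ.2))) := by
    rw [sq_stepCharNorm]; ring
  rw [hexpand]
  generalize (p : ℝ) = p at *
  generalize 1 - cos θ.1 = a at *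
  generalize 1 - cos θ.2 = b at *
  have hfactor : p * (1 - p) * a + p ^ 2 / 4 * (a + b) ≤ p * (3 - 2 * p) * a + p * b := by
    nlinarith [mul_nonneg hp0 ha, mul_nonneg hp0 hb, mul_nonneg (mul_nonneg hp0 hp1) ha,
      mul_nonneg (mul_nonneg hp0 hp1) hb]
  have hremainder : (a + b) * (p * (1 - p) * a + p ^ 2 / 4 * (a + b)) ≤
      ε * (p * (3 - 2 * p) * a + p * b) :=
    mul_le_mul hε hfactor (by positivity) (by linarith)
  linarith

lemma one_sub_mul_sq_le_one_sub_cos {t : ℝ} (hε : ε ≤ 1) (ht : |t| ≤ ε) :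
    (1 - ε) * (t ^ 2 / 2) ≤ 1 - cos t := by
  have hcos := (abs_le.1 (cos_bound (ht.trans hε))).2
  have hquartic : |t| ^ 4 ≤ ε * t ^ 2 := by
    rw [← sq_abs t]
    have : |t| * |t| ≤ ε * 1 := mul_le_mul ht (ht.trans hε) (abs_nonneg t) ((abs_nonneg t).trans ht)
    nlinarith [sq_nonneg |t|]
  nlinarith [pow_nonneg (abs_nonneg t) 4]

/-- The Gaussian in `θ` whose logarithm is `κ` times the second-order expansion of
`log (stepCharNorm p θ)` at the origin. -/
noncomputable def gaussianBound (κ : ℝ) (p : unitInterval) (θ : ℝ × ℝ) : ℝ :=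
  exp (-(κ * p * (3 - 2 * p) / 4) * θ.1 ^ 2) * exp (-(κ * p / 4) * θ.2 ^ 2)

lemma gaussianBound_nonneg (κ : ℝ) (p : unitInterval) (θ : ℝ × ℝ) : 0 ≤ gaussianBound κ p θ := by
  unfold gaussianBound; positivity

lemma gaussianBound_pow (κ : ℝ) (p : unitInterval) (θ : ℝ × ℝ) (n : ℕ) :
    gaussianBound κ p θ ^ n = gaussianBound (n * κ) p θ := by
  simp only [gaussianBound, mul_pow, ← exp_nat_mul]
  congr 2 <;> ring

lemma three_sub_two_mul_pos (p : unitInterval) : (0 : ℝ) < 3 - 2 * p := by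
  linarith [p.2.2]

lemma integrable_gaussianBound (hκ : 0 < κ) (hp : 0 < (p : ℝ)) :
    Integrable (gaussianBound κ p) := by
  have := three_sub_two_mul_pos p
  exact (integrable_exp_neg_mul_sq (by positivity)).mul_prod
    (integrable_exp_neg_mul_sq (by positivity))

lemma integral_gaussianBound (hκ : 0 < κ) (hp : 0 < (p : ℝ)) :
    ∫ θ, gaussianBound κ p θ = 4 * π / (κ * p * √(3 - 2 * p)) := by
  have h3 := three_sub_two_mul_pos p
  unfold gaussianBound
  rw [Measure.volume_eq_prod,
    integral_prod_mul (fun a : ℝ => exp (-(κ * p * (3 - 2 * p) / 4) * a ^ 2))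
      (fun b : ℝ => exp (-(κ * p / 4) * b ^ 2)), integral_gaussian, integral_gaussian,
    ← Real.sqrt_mul (by positivity), Real.sqrt_eq_iff_mul_self_eq (by positivity) (by positivity)]
  field_simp
  rw [mul_comm (p : ℝ) 2, Real.sq_sqrt h3.le]

lemma stepCharNorm_le_gaussianBound (hε : ε ≤ 1) (h₁ : |θ.1| ≤ ε) (h₂ : |θ.2| ≤ ε) :
    stepCharNorm p θ ≤ gaussianBound ((1 - ε) ^ 2) p θ := by
  have hp0 : (0 : ℝ) ≤ p := p.2.1
  have h3 := three_sub_two_mul_pos p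
  have hsmall {t : ℝ} (ht : |t| ≤ ε) : 1 - cos t ≤ ε / 2 := by
    have : t ^ 2 ≤ ε := by rw [← sq_abs]; nlinarith [abs_nonneg t]
    linarith [one_sub_sq_div_two_le_cos (x := t)]
  rw [← sq_le_sq₀ (stepCharNorm_nonneg _ _) (gaussianBound_nonneg _ _ _)]
  calc stepCharNorm p θ ^ 2
      ≤ 1 - (1 - ε) * (p * (3 - 2 * p) * (1 - cos θ.1) + p * (1 - cos θ.2)) :=
        sq_stepCharNorm_le (by linarith [hsmall h₁, hsmall h₂])
    _ ≤ 1 - (1 - ε) * (p * (3 - 2 * p) * ((1 - ε) * (θ.1 ^ 2 / 2)) +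
          p * ((1 - ε) * (θ.2 ^ 2 / 2))) := by
        gcongr
        · exact one_sub_mul_sq_le_one_sub_cos hε h₁
        · exact one_sub_mul_sq_le_one_sub_cos hε h₂
    _ ≤ exp (-((1 - ε) * (p * (3 - 2 * p) * ((1 - ε) * (θ.1 ^ 2 / 2)) +
          p * ((1 - ε) * (θ.2 ^ 2 / 2))))) := one_sub_le_exp_neg _
    _ = gaussianBound ((1 - ε) ^ 2) p θ ^ 2 := by
        rw [gaussianBound_pow, gaussianBound, ← exp_add]
        push_cast
        ring_nf

lemma stepCharNorm_sub_pi (p : unitInterval) (θ : ℝ × ℝ) :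
    stepCharNorm p (θ - (π, π)) = stepCharNorm p θ := by
  rw [← sq_eq_sq₀ (stepCharNorm_nonneg _ _) (stepCharNorm_nonneg _ _)]
  simp only [sq_stepCharNorm, Prod.fst_sub, Prod.snd_sub, cos_sub_pi]
  ring

lemma stepCharNorm_lt_one (hp : 0 < (p : ℝ))
    (hθ : θ ∈ Icc (-(π / 2), -(π / 2)) (3 * π / 2, 3 * π / 2)) (h0 : θ ≠ 0)
    (hpi : θ ≠ (π, π)) : stepCharNorm p θ < 1 := by
  obtain ⟨⟨hl₁, hl₂⟩, hu₁, hu₂⟩ := hθ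
  have hp1 : (0 : ℝ) ≤ 1 - p := sub_nonneg.2 p.2.2
  have hzero {t : ℝ} (hl : -(π / 2) ≤ t) (hu : t ≤ 3 * π / 2) (h : cos t = 1) : t = 0 :=
    (cos_eq_one_iff_of_lt_of_lt (by linarith [pi_pos]) (by linarith [pi_pos])).1 h
  have hpole {t : ℝ} (hl : -(π / 2) ≤ t) (hu : t ≤ 3 * π / 2) (h : cos t = -1) : t = π :=
    sub_eq_zero.1 <| (cos_eq_one_iff_of_lt_of_lt (by linarith [pi_pos]) (by linarith [pi_pos])).1
      (by rw [cos_sub_pi, h, neg_neg])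
  have hle₁ := cos_le_one θ.1
  have hle₂ := cos_le_one θ.2
  have hge₁ := neg_one_le_cos θ.1
  have hge₂ := neg_one_le_cos θ.2
  have hlt : cos θ.1 + cos θ.2 < 2 := by
    by_contra!
    exact h0 (Prod.ext (hzero hl₁ hu₁ (by linarith)) (hzero hl₂ hu₂ (by linarith)))
  have hgt : -2 < cos θ.1 + cos θ.2 := by
    by_contra!
    exact hpi (Prod.ext (hpole hl₁ hu₁ (by linarith)) (hpole hl₂ hu₂ (by linarith)))
  have hsq : (cos θ.1 + cos θ.2) ^ 2 < 4 := by nlinarith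
  have hmul : cos θ.1 * (cos θ.1 + cos θ.2) ≤ 2 := by nlinarith
  have := mul_lt_mul_of_pos_left hsq (by positivity : 0 < (p : ℝ) ^ 2 / 4)
  have := mul_le_mul_of_nonneg_left hmul (mul_nonneg hp.le hp1)
  rw [← sq_lt_one_iff₀ (stepCharNorm_nonneg _ _), sq_stepCharNorm]
  nlinarith

lemma exists_stepCharNorm_le_of_dist (hp : 0 < (p : ℝ)) (hε : 0 < ε) :
    ∃ η ∈ Ico (0 : ℝ) 1, ∀ θ ∈ box, ε ≤ ‖θ‖ → ε ≤ ‖θ - (π, π)‖ → stepCharNorm p θ ≤ η := by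
  let K : Set (ℝ × ℝ) := Icc (-(π / 2), -(π / 2)) (3 * π / 2, 3 * π / 2) ∩
    {θ | ε ≤ ‖θ‖ ∧ ε ≤ ‖θ - (π, π)‖}
  have hK : IsCompact K := isCompact_Icc.inter_right <|
    (isClosed_le continuous_const continuous_norm).inter
      (isClosed_le continuous_const (continuous_id.sub continuous_const).norm)
  rcases K.eq_empty_or_nonempty with hempty | hne
  · exact ⟨0, by simp, fun θ hθ h0 hpi =>
      (hempty.subset ⟨box_subset_Icc hθ, h0, hpi⟩ : θ ∈ (∅ : Set (ℝ × ℝ))).elim⟩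
  · obtain ⟨φ, ⟨hφ, h0, hpi⟩, hmax⟩ :=
      hK.exists_isMaxOn hne (continuous_stepCharNorm p).continuousOn
    refine ⟨stepCharNorm p φ, ⟨stepCharNorm_nonneg p φ, stepCharNorm_lt_one hp hφ ?_ ?_⟩,
      fun θ hθ h0 hpi => hmax ⟨box_subset_Icc hθ, h0, hpi⟩⟩
    · rintro rfl
      simp [hε.not_ge] at h0
    · rintro rfl
      simp [hε.not_ge] at hpi

lemma exists_stepCharNorm_pow_le (hp : 0 < (p : ℝ)) (hκ : κ ∈ Ioo (0 : ℝ) 1) :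
    ∃ η ∈ Ico (0 : ℝ) 1, ∀ n : ℕ, ∀ θ ∈ box, stepCharNorm p θ ^ n ≤
      gaussianBound (n * κ) p θ + gaussianBound (n * κ) p (θ - (π, π)) + η ^ n := by
  have hε : 0 < 1 - √κ := sub_pos.2 ((Real.sqrt_lt' one_pos).2 (by simpa using hκ.2))
  have hlocal (φ : ℝ × ℝ) (hφ : ‖φ‖ < 1 - √κ) : stepCharNorm p φ ≤ gaussianBound κ p φ := by
    have h := stepCharNorm_le_gaussianBound (p := p) (sub_le_self 1 (Real.sqrt_nonneg κ))
      ((norm_fst_le φ).trans hφ.le) ((norm_snd_le φ).trans hφ.le)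
    rwa [sub_sub_cancel, Real.sq_sqrt hκ.1.le] at h
  obtain ⟨η, hη, hfar⟩ := exists_stepCharNorm_le_of_dist hp hε
  refine ⟨η, hη, fun n θ hθ => ?_⟩
  simp only [← gaussianBound_pow]
  have hG := pow_nonneg (gaussianBound_nonneg κ p θ) n
  have hG' := pow_nonneg (gaussianBound_nonneg κ p (θ - (π, π))) n
  have hηn := pow_nonneg hη.1 n
  have hs := stepCharNorm_nonneg p θ
  by_cases h0 : ‖θ‖ < 1 - √κ
  · linarith [pow_le_pow_left₀ hs (hlocal θ h0) n]
  by_cases hpi : ‖θ - (π, π)‖ < 1 - √κ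
  · have h := hlocal _ hpi
    rw [stepCharNorm_sub_pi] at h
    linarith [pow_le_pow_left₀ hs h n]
  · linarith [pow_le_pow_left₀ hs (hfar θ hθ (not_lt.1 h0) (not_lt.1 hpi)) n]

/-- The constant of the local limit theorem: the largest point probability at time `n` is
asymptotically at most `heatConst p / n`. The factor `2` accounts for the periodicity. -/
noncomputable def heatConst (p : unitInterval) : ℝ := 2 / (π * p * √(3 - 2 * p))

lemma heatConst_nonneg (p : unitInterval) : 0 ≤ heatConst p := by
  have hp : 0 ≤ (p : ℝ) := p.2.1
  unfold heatConst
  positivity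

lemma exists_integral_stepCharNorm_pow_le (hp : 0 < (p : ℝ)) (hκ : κ ∈ Ioo (0 : ℝ) 1) :
    ∃ η ∈ Ico (0 : ℝ) 1, ∀ n : ℕ, n ≠ 0 → ∫ θ in box, stepCharNorm p θ ^ n ≤
      4 * π ^ 2 * (heatConst p / (n * κ) + η ^ n) := by
  obtain ⟨η, hη, hle⟩ := exists_stepCharNorm_pow_le hp hκ
  refine ⟨η, hη, fun n hn => ?_⟩
  have hnκ : 0 < n * κ := mul_pos (by positivity) hκ.1
  have hint : Integrable (gaussianBound (n * κ) p) := integrable_gaussianBound hnκ hp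
  have hint' : Integrable fun θ => gaussianBound (n * κ) p (θ - (π, π)) := hint.comp_sub_right _
  have hconst : IntegrableOn (fun _ : ℝ × ℝ => η ^ n) box := integrableOn_box continuous_const
  have hvol : volume.real box = 4 * π ^ 2 := by
    rw [box, Measure.real, Measure.volume_eq_prod, Measure.prod_prod, ENNReal.toReal_mul,
      Real.volume_Ioc, ENNReal.toReal_ofReal (by linarith [pi_pos])]
    ring
  calc ∫ θ in box, stepCharNorm p θ ^ n
      ≤ ∫ θ in box, (gaussianBound (n * κ) p θ + gaussianBound (n * κ) p (θ - (π, π)) + η ^ n) :=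
        setIntegral_mono_on (integrableOn_box ((continuous_stepCharNorm p).pow n))
          ((hint.integrableOn.add hint'.integrableOn).add hconst) measurableSet_box (hle n)
    _ = (∫ θ in box, gaussianBound (n * κ) p θ) +
          (∫ θ in box, gaussianBound (n * κ) p (θ - (π, π))) + 4 * π ^ 2 * η ^ n := by
        rw [integral_add (by exact hint.integrableOn.add hint'.integrableOn) hconst,
          integral_add hint.integrableOn hint'.integrableOn, setIntegral_const, hvol, smul_eq_mul]
    _ ≤ (∫ θ, gaussianBound (n * κ) p θ) + (∫ θ, gaussianBound (n * κ) p (θ - (π, π))) +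
          4 * π ^ 2 * η ^ n := by
        gcongr ?_ + ?_ + _
        · exact setIntegral_le_integral hint (.of_forall (gaussianBound_nonneg _ p))
        · exact setIntegral_le_integral hint' (.of_forall fun θ => gaussianBound_nonneg _ p _)
    _ = 4 * π ^ 2 * (heatConst p / (n * κ) + η ^ n) := by
        rw [integral_sub_right_eq_self, integral_gaussianBound hnκ hp, heatConst]
        field_simp
        ring

/-- The factor `n` makes the bound hold at `n = 0` as well. -/
theorem exists_nat_mul_law_walk_eq_le (hp : 0 < (p : ℝ)) (hκ : κ ∈ Ioo (0 : ℝ) 1) :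
    ∃ e : ℕ → ℝ≥0∞, ∑' n, e n ≠ ⊤ ∧ ∀ (n : ℕ) (x : Instructions) (w : ℤ × ℤ),
      n * law p x {ω | walk n ω = w} ≤ ENNReal.ofReal (heatConst p / κ) + e n := by
  obtain ⟨η, hη, hle⟩ := exists_integral_stepCharNorm_pow_le hp hκ
  have hsum : Summable fun n : ℕ => n * η ^ n := by
    simpa using summable_pow_mul_geometric_of_norm_lt_one 1
      (by simpa [abs_of_nonneg hη.1] using hη.2 : ‖η‖ < 1)
  have hheat : 0 ≤ heatConst p / κ := div_nonneg (heatConst_nonneg p) hκ.1.le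
  refine ⟨fun n => ENNReal.ofReal (n * η ^ n), hsum.tsum_ofReal_ne_top, fun n x w => ?_⟩
  rcases eq_or_ne n 0 with rfl | hn
  · simp
  have hbound : (law p x).real {ω | walk n ω = w} ≤ heatConst p / (n * κ) + η ^ n :=
    le_of_mul_le_mul_left
      ((law_walk_eq_le_integral_stepCharNorm_pow p x hn w).trans (hle n hn)) (by positivity)
  have hκ0 := hκ.1.ne'
  rw [← ENNReal.ofReal_add hheat (mul_nonneg n.cast_nonneg (pow_nonneg hη.1 n)),
    ← ofReal_measureReal, ← ENNReal.ofReal_natCast, ← ENNReal.ofReal_mul n.cast_nonneg]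
  refine ENNReal.ofReal_le_ofReal ?_
  calc n * (law p x).real {ω | walk n ω = w} ≤ n * (heatConst p / (n * κ) + η ^ n) := by gcongr
    _ = heatConst p / κ + n * η ^ n := by field_simp

end LocalBound

end Fourier

section Hitting

variable {v : ℤ × ℤ} {ω : ℕ → ℤ × ℤ}

lemma hittingTime_le {t : ℕ} (h : walk t ω = v) : hittingTime v ω ≤ t := iInf₂_le t h

lemma natCast_lt_hittingTime_iff {s : ℕ} :
    (s : ℝ≥0∞) < hittingTime v ω ↔ ∀ j ≤ s, walk j ω ≠ v := by
  refine ⟨fun h j hj hv => ?_, fun h => ?_⟩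
  · exact h.not_ge ((hittingTime_le hv).trans (by exact_mod_cast hj))
  · calc (s : ℝ≥0∞) < (s + 1 : ℕ) := by exact_mod_cast s.lt_succ_self
      _ ≤ hittingTime v ω := le_iInf₂ fun t ht => by
        exact_mod_cast not_le.1 fun hts => h t hts ht

lemma hittingTime_eq_natCast_iff {r : ℕ} :
    hittingTime v ω = r ↔ walk r ω = v ∧ ∀ j < r, walk j ω ≠ v := by
  refine ⟨fun h => ?_, fun ⟨hr, hlt⟩ => (hittingTime_le hr).antisymm <| le_iInf₂ fun t ht => ?_⟩
  · have hlt (j : ℕ) (hj : j < r) : walk j ω ≠ v := fun hv =>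
      (hittingTime_le hv).not_gt (by rw [h]; exact_mod_cast hj)
    have hle : ¬ ∀ j ≤ r, walk j ω ≠ v := fun hall => (natCast_lt_hittingTime_iff.2 hall).ne' h
    push Not at hle
    obtain ⟨j, hj, hv⟩ := hle
    obtain rfl : j = r := hj.eq_of_not_lt fun hjr => hlt j hjr hv
    exact ⟨hv, hlt⟩
  · exact_mod_cast not_lt.1 fun htr => hlt t htr ht

lemma exists_hittingTime_eq (h : hittingTime v ω ≠ ⊤) : ∃ r : ℕ, hittingTime v ω = r := by
  classical
  have hvisit : ∃ t, walk t ω = v := by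
    by_contra! hnever
    exact h (by simp [hittingTime, hnever])
  exact ⟨Nat.find hvisit, hittingTime_eq_natCast_iff.2
    ⟨Nat.find_spec hvisit, fun _ => Nat.find_min hvisit⟩⟩

lemma dependsOn_natCast_lt_hittingTime (v : ℤ × ℤ) (s : ℕ) :
    DependsOn (· ∈ {ω | (s : ℝ≥0∞) < hittingTime v ω}) (Iio s) := fun ω ω' h => by
  simp only [mem_ofPred_eq, natCast_lt_hittingTime_iff]
  exact propext (forall₂_congr fun j hj => by rw [dependsOn_walk hj h])

lemma dependsOn_hittingTime_eq (v : ℤ × ℤ) (r : ℕ) :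
    DependsOn (· ∈ {ω | hittingTime v ω = r}) (Iio r) := fun ω ω' h => by
  simp only [mem_ofPred_eq, hittingTime_eq_natCast_iff, dependsOn_walk le_rfl h]
  exact propext (and_congr_right' (forall₂_congr fun j hj => by rw [dependsOn_walk hj.le h]))

lemma measurableSet_hittingTime_eq (v : ℤ × ℤ) (r : ℕ) :
    MeasurableSet {ω | hittingTime v ω = r} :=
  measurableSet_of_dependsOn (dependsOn_hittingTime_eq v r)

lemma pairwise_disjoint_hittingTime_eq (v : ℤ × ℤ) :
    Pairwise (Function.onFun Disjoint fun r : ℕ => {ω | hittingTime v ω = r}) :=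
  fun r s hrs => disjoint_left.2 fun ω hr hs => hrs (by exact_mod_cast hr.symm.trans hs)

lemma measurable_hittingTime (v : ℤ × ℤ) : Measurable (hittingTime v) := by
  classical
  unfold hittingTime
  refine Measurable.iInf fun t => ?_
  simp only [iInf_eq_if]
  exact Measurable.ite (measurableSet_walk_eq t v) measurable_const measurable_const

lemma tsum_indicator_lt_hittingTime_le (v : ℤ × ℤ) (ω : ℕ → ℤ × ℤ) :
    ∑' s : ℕ, {ω | (s : ℝ≥0∞) < hittingTime v ω}.indicator 1 ω ≤ hittingTime v ω := by
  refine le_iInf₂ fun t ht => ?_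
  rw [tsum_eq_sum (s := Finset.range t) fun s hs => indicator_of_notMem (fun h => ?_) _]
  · exact (Finset.sum_le_card_nsmul _ _ 1 fun s _ =>
      indicator_le_self' (fun _ _ => zero_le) ω).trans (by simp)
  · exact natCast_lt_hittingTime_iff.1 h t (not_lt.1 (Finset.mem_range.not.1 hs)) ht

lemma tsum_law_lt_hittingTime_le (p : unitInterval) (x : Instructions) (v : ℤ × ℤ) :
    ∑' s : ℕ, law p x {ω | s < hittingTime v ω} ≤ expectedHittingTime p x v := by
  have hmeas (s : ℕ) : MeasurableSet {ω | (s : ℝ≥0∞) < hittingTime v ω} :=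
    measurableSet_of_dependsOn (dependsOn_natCast_lt_hittingTime v s)
  simp only [← fun s => lintegral_indicator_one (μ := law p x) (hmeas s)]
  rw [← lintegral_tsum fun s => (measurable_one.indicator (hmeas s)).aemeasurable]
  exact lintegral_mono (tsum_indicator_lt_hittingTime_le v)

lemma expectedHittingTime_eq_tsum {p : unitInterval} {x : Instructions}
    (h : expectedHittingTime p x v ≠ ⊤) :
    expectedHittingTime p x v = ∑' r : ℕ, r * law p x {ω | hittingTime v ω = r} := by
  have hcover : ∀ᵐ ω ∂law p x, ω ∈ ⋃ r : ℕ, {ω | hittingTime v ω = r} := by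
    filter_upwards [ae_lt_top (measurable_hittingTime v) h] with ω hω
    exact mem_iUnion.2 (exists_hittingTime_eq hω.ne)
  calc expectedHittingTime p x v
      = ∫⁻ ω in ⋃ r : ℕ, {ω | hittingTime v ω = r}, hittingTime v ω ∂law p x := by
        rw [expectedHittingTime, Measure.restrict_eq_self_of_ae_mem hcover]
    _ = ∑' r : ℕ, ∫⁻ ω in {ω | hittingTime v ω = r}, hittingTime v ω ∂law p x :=
        lintegral_iUnion (measurableSet_hittingTime_eq v) (pairwise_disjoint_hittingTime_eq v) _
    _ = ∑' r : ℕ, r * law p x {ω | hittingTime v ω = r} := tsum_congr fun r => by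
        rw [setLIntegral_congr_fun (measurableSet_hittingTime_eq v r) fun ω hω => hω,
          setLIntegral_const]

end Hitting

section Renewal

variable {v : ℤ × ℤ} {ω : ℕ → ℤ × ℤ} {p : unitInterval} {x : Instructions}

lemma natCast_visits (τ : ℕ) (ω : ℕ → ℤ × ℤ) : (visits τ ω : ℝ≥0∞) =
    ∑ m ∈ Finset.range (τ + 1), {ω | walk m ω = 0}.indicator 1 ω := by
  rw [visits, Finset.card_filter, Nat.cast_sum]
  exact Finset.sum_congr rfl fun m _ => by simp [indicator_apply]

lemma measurable_visits (τ : ℕ) : Measurable fun ω => (visits τ ω : ℝ≥0∞) := by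
  simp only [natCast_visits]
  exact Finset.measurable_fun_sum _ fun m _ => measurable_one.indicator (measurableSet_walk_eq m 0)

/-- The event that the walk is at `v` at time `t` and was not there during the first half
`{0, …, t / 2}` of that time span. -/
def lateVisit (v : ℤ × ℤ) (t : ℕ) : Set (ℕ → ℤ × ℤ) :=
  {ω | ((t / 2 : ℕ) : ℝ≥0∞) < hittingTime v ω} ∩ {ω | walk t ω = v}

lemma measurableSet_lateVisit (v : ℤ × ℤ) (t : ℕ) : MeasurableSet (lateVisit v t) :=
  (measurableSet_of_dependsOn (dependsOn_natCast_lt_hittingTime v _)).inter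
    (measurableSet_walk_eq t v)

lemma mul_visits_drop_le {r τ : ℕ} (hτ : τ < r) (hr : hittingTime v ω = r) :
    (r : ℝ≥0∞) * visits τ (drop r ω) ≤ ∑' t : ℕ, (t : ℝ≥0∞) * (lateVisit v t).indicator 1 ω := by
  have hreturn {m : ℕ} (hm : m < r) (h : walk m (drop r ω) = 0) : ω ∈ lateVisit v (r + m) := by
    refine ⟨?_, by simp [walk_add, h, (hittingTime_eq_natCast_iff.1 hr).1]⟩
    rw [mem_ofPred_eq, hr]
    exact_mod_cast (by omega : (r + m) / 2 < r)
  calc (r : ℝ≥0∞) * visits τ (drop r ω)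
      = ∑ m ∈ Finset.range (τ + 1), (r : ℝ≥0∞) * {ω | walk m ω = 0}.indicator 1 (drop r ω) := by
        rw [natCast_visits, Finset.mul_sum]
    _ ≤ ∑ m ∈ Finset.range (τ + 1), ((r + m : ℕ) : ℝ≥0∞) * (lateVisit v (r + m)).indicator 1 ω := by
        refine Finset.sum_le_sum fun m hm => ?_
        by_cases h : drop r ω ∈ {ω | walk m ω = 0}
        · rw [indicator_of_mem h, indicator_of_mem
            (hreturn (by rw [Finset.mem_range] at hm; omega) h)]
          gcongr
          exacts [Nat.le_add_right r m, le_rfl]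
        · rw [indicator_of_notMem h, mul_zero]
          exact zero_le
    _ ≤ ∑' m : ℕ, ((r + m : ℕ) : ℝ≥0∞) * (lateVisit v (r + m)).indicator 1 ω :=
        ENNReal.sum_le_tsum _
    _ ≤ ∑' t : ℕ, (t : ℝ≥0∞) * (lateVisit v t).indicator 1 ω :=
        ENNReal.tsum_comp_le_tsum_of_injective (add_right_injective r)
          fun t : ℕ => (t : ℝ≥0∞) * (lateVisit v t).indicator 1 ω

lemma mul_law_hittingTime_eq_le (v : ℤ × ℤ) (τ r : ℕ) {R : ℝ≥0∞}
    (hR : ∀ y, R ≤ ∫⁻ ω, visits τ ω ∂law p y) :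
    R * (r * law p x {ω | hittingTime v ω = r}) ≤
      R * τ * law p x {ω | hittingTime v ω = r} +
        ∫⁻ ω in {ω | hittingTime v ω = r}, ∑' t : ℕ, (t : ℝ≥0∞) * (lateVisit v t).indicator 1 ω
          ∂law p x := by
  rcases le_or_gt r τ with hr | hr
  · refine le_trans ?_ le_self_add
    rw [← mul_assoc]
    gcongr
  · refine le_trans ?_ le_add_self
    calc R * (r * law p x {ω | hittingTime v ω = r})
        ≤ (∫⁻ ω, visits τ ω ∂law p (x.shift r)) * (r * law p x {ω | hittingTime v ω = r}) := by
          gcongr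
          exact hR _
      _ = r * ∫⁻ ω in {ω | hittingTime v ω = r}, visits τ (drop r ω) ∂law p x := by
          rw [setLIntegral_comp_drop_law p x (dependsOn_hittingTime_eq v r)
            (measurable_visits τ)]
          ring
      _ = ∫⁻ ω in {ω | hittingTime v ω = r}, r * visits τ (drop r ω) ∂law p x :=
          (lintegral_const_mul _ ((measurable_visits τ).comp (measurable_drop r))).symm
      _ ≤ _ := setLIntegral_mono' (measurableSet_hittingTime_eq v r) fun ω hω =>
          mul_visits_drop_le hr hω

/-- The walk restarts at its first visit to `v`, so if that visit comes after time `τ`, it is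
followed by at least `R` expected visits to `v` during the next `τ` steps, all of them late. -/
theorem mul_expectedHittingTime_le (h : expectedHittingTime p x v ≠ ⊤) (τ : ℕ) {R : ℝ≥0∞}
    (hR : ∀ y, R ≤ ∫⁻ ω, visits τ ω ∂law p y) :
    R * expectedHittingTime p x v ≤ R * τ + ∑' t : ℕ, t * law p x (lateVisit v t) := by
  have hmeas (t : ℕ) : Measurable ((lateVisit v t).indicator (1 : (ℕ → ℤ × ℤ) → ℝ≥0∞)) :=
    measurable_one.indicator (measurableSet_lateVisit v t)
  have hunion := measure_iUnion (μ := law p x) (pairwise_disjoint_hittingTime_eq v)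
    (measurableSet_hittingTime_eq v)
  calc R * expectedHittingTime p x v
      = ∑' r : ℕ, R * (r * law p x {ω | hittingTime v ω = r}) := by
        rw [expectedHittingTime_eq_tsum h, ENNReal.tsum_mul_left]
    _ ≤ R * τ * law p x (⋃ r : ℕ, {ω | hittingTime v ω = r}) +
          ∫⁻ ω in ⋃ r : ℕ, {ω | hittingTime v ω = r},
            ∑' t : ℕ, (t : ℝ≥0∞) * (lateVisit v t).indicator 1 ω ∂law p x := by
        rw [hunion, lintegral_iUnion (measurableSet_hittingTime_eq v)
          (pairwise_disjoint_hittingTime_eq v), ← ENNReal.tsum_mul_left, ← ENNReal.tsum_add]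
        exact ENNReal.tsum_le_tsum fun r => mul_law_hittingTime_eq_le v τ r hR
    _ ≤ R * τ + ∫⁻ ω, ∑' t : ℕ, (t : ℝ≥0∞) * (lateVisit v t).indicator 1 ω ∂law p x :=
        add_le_add (mul_le_of_le_one_right' prob_le_one) (setLIntegral_le_lintegral _ _)
    _ = R * τ + ∑' t : ℕ, t * law p x (lateVisit v t) := by
        rw [lintegral_tsum fun t => ((hmeas t).const_mul (t : ℝ≥0∞)).aemeasurable]
        simp only [lintegral_const_mul _ (hmeas _),
          lintegral_indicator_one (measurableSet_lateVisit v _)]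

/-- A visit to `v` at time `2 * j + b` not preceded by one up to time `j` forces the walk to
reach the point `v` exactly `j + b` steps after time `j`. -/
lemma mul_law_lateVisit_two_mul_add_le (x : Instructions) (v : ℤ × ℤ) {b : ℕ} (hb : b ≤ 1) (j : ℕ)
    {C : ℝ≥0∞} (hC : ∀ y w, (j + b : ℕ) * law p y {ω | walk (j + b) ω = w} ≤ C) :
    (2 * j + b : ℕ) * law p x (lateVisit v (2 * j + b)) ≤
      2 * (law p x {ω | j < hittingTime v ω} * C) := by
  have hhalf : (2 * j + b) / 2 = j := by omega
  have hsup : law p x (lateVisit v (2 * j + b)) ≤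
      law p x {ω | j < hittingTime v ω} *
        ⨆ w, law p (x.shift j) {ω | walk (j + b) ω = w} := by
    rw [lateVisit, hhalf, two_mul, add_assoc]
    exact law_inter_walk_add_eq_le p x v (dependsOn_natCast_lt_hittingTime v j) (j + b)
  calc ((2 * j + b : ℕ) : ℝ≥0∞) * law p x (lateVisit v (2 * j + b))
      ≤ (2 * (j + b : ℕ)) * (law p x {ω | j < hittingTime v ω} *
          ⨆ w, law p (x.shift j) {ω | walk (j + b) ω = w}) := by
        gcongr
        exact_mod_cast (by omega : 2 * j + b ≤ 2 * (j + b))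
    _ = 2 * (law p x {ω | j < hittingTime v ω} *
          ⨆ w, ((j + b : ℕ) : ℝ≥0∞) * law p (x.shift j) {ω | walk (j + b) ω = w}) := by
        rw [← ENNReal.mul_iSup]
        ring
    _ ≤ 2 * (law p x {ω | j < hittingTime v ω} * C) := by
        gcongr
        exact iSup_le fun w => hC _ w

/-- By parity, `v` can only be reached at times `2 * j + b` for a single `b ∈ {0, 1}`. -/
theorem tsum_mul_law_lateVisit_le (x : Instructions) (v : ℤ × ℤ) {D : ℝ≥0∞} {e : ℕ → ℝ≥0∞}
    (hD : ∀ (n : ℕ) (y : Instructions) (w : ℤ × ℤ), n * law p y {ω | walk n ω = w} ≤ D + e n) :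
    ∑' t : ℕ, t * law p x (lateVisit v t) ≤
      2 * (D * expectedHittingTime p x v + ∑' n, e n) := by
  obtain ⟨b, hb, hparity⟩ : ∃ b ≤ 1, Even (v.1 + v.2 - (b : ℕ)) := by
    rcases Int.even_or_odd (v.1 + v.2) with h | h
    · exact ⟨0, by simp, by simpa using h⟩
    · exact ⟨1, le_rfl, by simpa using h.sub_odd odd_one⟩
  have hinj : Function.Injective fun j => 2 * j + b := fun i j h => by simpa using h
  have hvanish (t : ℕ) (ht : t ∉ range fun j => 2 * j + b) : t * law p x (lateVisit v t) = 0 := by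
    have hodd : ¬ Even (v.1 + v.2 - (t : ℤ)) := fun heven => ht ⟨(t - b) / 2, by grind⟩
    rw [lateVisit, measure_mono_null inter_subset_right (law_walk_eq_zero_of_not_even p x hodd),
      mul_zero]
  have hterm (j : ℕ) : ((2 * j + b : ℕ) : ℝ≥0∞) * law p x (lateVisit v (2 * j + b)) ≤
      2 * (D * law p x {ω | j < hittingTime v ω} + e (j + b)) := by
    refine (mul_law_lateVisit_two_mul_add_le x v hb j (hD (j + b))).trans ?_
    rw [mul_add, mul_comm D]
    gcongr
    exact mul_le_of_le_one_left' prob_le_one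
  calc ∑' t : ℕ, t * law p x (lateVisit v t)
      = ∑' j : ℕ, ((2 * j + b : ℕ) : ℝ≥0∞) * law p x (lateVisit v (2 * j + b)) :=
        (hinj.tsum_eq fun t ht => by_contra fun h => ht (hvanish t h)).symm
    _ ≤ 2 * (D * ∑' j : ℕ, law p x {ω | j < hittingTime v ω} + ∑' j, e (j + b)) := by
        rw [← ENNReal.tsum_mul_left, ← ENNReal.tsum_add, ← ENNReal.tsum_mul_left]
        exact ENNReal.tsum_le_tsum hterm
    _ ≤ 2 * (D * expectedHittingTime p x v + ∑' n, e n) := by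
        gcongr 2 * (D * ?_ + ?_)
        · exact tsum_law_lt_hittingTime_le p x v
        · exact ENNReal.tsum_comp_le_tsum_of_injective (add_left_injective b) e

end Renewal

section FarHome

variable {p : unitInterval} {x : Instructions} {u v : ℤ × ℤ} {ω : ℕ → ℤ × ℤ} {k : ℕ}

lemma natCast_le_expectedHittingTime (p : unitInterval) (x : Instructions) (h : (k : ℝ) ≤ ‖v‖) :
    k ≤ expectedHittingTime p x v := by
  have hle : ∀ᵐ ω ∂law p x, (k : ℝ≥0∞) ≤ hittingTime v ω := by
    filter_upwards [ae_mem_unitSteps_law p x] with ω hω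
    refine le_iInf₂ fun t ht => ?_
    exact_mod_cast h.trans (ht ▸ norm_walk_le hω t)
  simpa [expectedHittingTime] using lintegral_mono_ae hle

lemma stepLaw_singleton_ne_zero (hp : 0 < (p : ℝ)) (v : ℤ × ℤ) (hu : u ∈ unitSteps) :
    stepLaw p v {u} ≠ 0 := by
  have hterm : ENNReal.ofReal (p / 4) * Measure.dirac u {u} ≠ 0 := by simp [hp]
  refine ((pos_iff_ne_zero.2 hterm).trans_le ?_).ne'
  simp only [stepLaw, Measure.coe_add, Measure.coe_smul, Measure.coe_finsetSum, Pi.add_apply,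
    Pi.smul_apply, Finset.sum_apply, smul_eq_mul]
  exact le_add_left (Finset.single_le_sum (f := fun w => ENNReal.ofReal (p / 4) *
    Measure.dirac w {u}) (fun _ _ => zero_le) hu)

lemma law_forall_lt_eq_ne_zero (hp : 0 < (p : ℝ)) (x : Instructions) (hu : u ∈ unitSteps) (k : ℕ) :
    law p x {ω | ∀ i < k, ω i = u} ≠ 0 := by
  have hpi : {ω : ℕ → ℤ × ℤ | ∀ i < k, ω i = u} = Set.pi (Finset.range k) fun _ => {u} := by
    ext; simp [Set.mem_pi]
  rw [hpi, law, Measure.infinitePi_pi _ fun i _ => measurableSet_singleton u]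
  exact Finset.prod_ne_zero_iff.2 fun i _ => stepLaw_singleton_ne_zero hp _ hu

lemma walk_eq_nsmul (hω : ∀ i < k, ω i = u) : walk k ω = k • u := by
  rw [walk, Finset.sum_congr rfl fun i hi => hω i (Finset.mem_range.1 hi), Finset.sum_const,
    Finset.card_range]

lemma hittingTime_sub_nsmul_drop_le (hω : ∀ i < k, ω i = u) (hv : ∀ j : ℕ, j • u ≠ v) :
    hittingTime (v - k • u) (drop k ω) ≤ hittingTime v ω := by
  refine le_iInf₂ fun t ht => ?_
  rcases lt_or_ge t k with htk | hkt
  · exact absurd (walk_eq_nsmul fun i hi => hω i (hi.trans htk)) (ht ▸ (hv t).symm)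
  · obtain ⟨m, rfl⟩ := Nat.exists_eq_add_of_le hkt
    rw [walk_add, walk_eq_nsmul hω] at ht
    calc hittingTime (v - k • u) (drop k ω) ≤ m := hittingTime_le (eq_sub_of_add_eq' ht)
      _ ≤ (k + m : ℕ) := by exact_mod_cast Nat.le_add_left m k

/-- With positive probability the first `k` steps all equal `u`, whatever the instructions, and then
the rest of the walk still has to find `v`. -/
lemma expectedHittingTime_shift_lt_top (hp : 0 < (p : ℝ)) (hu : u ∈ unitSteps)
    (hv : ∀ j : ℕ, j • u ≠ v) (h : expectedHittingTime p x v < ⊤) (k : ℕ) :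
    expectedHittingTime p (x.shift k) (v - k • u) < ⊤ := by
  set A : Set (ℕ → ℤ × ℤ) := {ω | ∀ i < k, ω i = u}
  have hA : DependsOn (· ∈ A) (Iio k) := fun ω ω' h =>
    propext (forall₂_congr fun i hi => by rw [h i hi])
  refine ENNReal.lt_top_of_mul_ne_top_right ?_ (law_forall_lt_eq_ne_zero hp x hu k)
  rw [expectedHittingTime, ← setLIntegral_comp_drop_law p x hA (measurable_hittingTime _)]
  refine ((lt_of_le_of_lt ?_) h).ne
  exact (setLIntegral_mono (measurable_hittingTime v) fun ω hω =>
    hittingTime_sub_nsmul_drop_le hω hv).trans (setLIntegral_le_lintegral _ _)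

lemma exists_unitSteps_le_norm_sub_nsmul (v : ℤ × ℤ) :
    ∃ u ∈ unitSteps, ∀ k : ℕ, (k : ℝ) ≤ ‖v - k • u‖ := by
  have hfst (w : ℤ × ℤ) : ((|w.1| : ℤ) : ℝ) ≤ ‖w‖ := by
    simpa [Int.norm_eq_abs] using norm_fst_le w
  rcases le_total 0 v.1 with hv | hv
  · refine ⟨(-1, 0), by decide, fun k => le_trans ?_ (hfst _)⟩
    exact_mod_cast le_abs.2 (.inl (by simpa using hv))
  · refine ⟨(1, 0), by decide, fun k => le_trans ?_ (hfst _)⟩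
    exact_mod_cast le_abs.2 (.inr (by simpa using hv))

theorem exists_natCast_le_expectedHittingTime_lt_top (hp : 0 < (p : ℝ)) (hv : v ≠ 0)
    (h : expectedHittingTime p x v < ⊤) (k : ℕ) :
    ∃ y w, k ≤ expectedHittingTime p y w ∧ expectedHittingTime p y w < ⊤ := by
  obtain ⟨u, hu, hfar⟩ := exists_unitSteps_le_norm_sub_nsmul v
  have hmiss (j : ℕ) : j • u ≠ v := fun hj => hv <| by
    obtain rfl : j = 0 := by simpa [hj] using hfar j
    rw [← hj, zero_nsmul]
  exact ⟨x.shift k, v - k • u, natCast_le_expectedHittingTime p _ (hfar k),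
    expectedHittingTime_shift_lt_top hp hu hmiss h k⟩

end FarHome

section MinReturns

variable {p : unitInterval} {x : Instructions} {v : ℤ × ℤ}

lemma one_le_visits (τ : ℕ) (ω : ℕ → ℤ × ℤ) : 1 ≤ visits τ ω :=
  Finset.card_pos.2 ⟨0, by simp [walk_zero]⟩

lemma integrable_visits (p : unitInterval) (x : Instructions) (τ : ℕ) :
    Integrable (fun ω => (visits τ ω : ℝ)) (law p x) := by
  refine .of_bound (C := τ + 1) (Measurable.aestronglyMeasurable ?_) (.of_forall fun ω => ?_)
  · simpa using (measurable_visits τ).ennreal_toReal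
  · rw [Real.norm_natCast]
    exact_mod_cast (Finset.card_filter_le _ _).trans (Finset.card_range _).le

lemma ofReal_minReturns_le (p : unitInterval) (x : Instructions) (τ : ℕ) :
    ENNReal.ofReal (minReturns τ p) ≤ ∫⁻ ω, visits τ ω ∂law p x := by
  have hbdd : BddBelow (range fun y => ∫ ω, (visits τ ω : ℝ) ∂law p y) :=
    ⟨0, forall_mem_range.2 fun y => integral_nonneg fun ω => Nat.cast_nonneg _⟩
  calc ENNReal.ofReal (minReturns τ p) ≤ ENNReal.ofReal (∫ ω, (visits τ ω : ℝ) ∂law p x) :=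
        ENNReal.ofReal_le_ofReal (ciInf_le hbdd x)
    _ = ∫⁻ ω, visits τ ω ∂law p x := by
        rw [ofReal_integral_eq_lintegral_ofReal (integrable_visits p x τ)
          (.of_forall fun ω => Nat.cast_nonneg _)]
        simp only [ENNReal.ofReal_natCast]

lemma one_le_minReturns [Nonempty Instructions] (τ : ℕ) (p : unitInterval) :
    1 ≤ minReturns τ p := by
  refine le_ciInf fun x => ?_
  simpa using integral_mono (integrable_const 1) (integrable_visits p x τ)
    fun ω => (by exact_mod_cast one_le_visits τ ω : (1 : ℝ) ≤ visits τ ω)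

lemma le_of_forall_exists_mul_le_mul_add {a b c : ℝ≥0∞} (hb : b ≠ ⊤)
    (h : ∀ k : ℕ, ∃ E : ℝ≥0∞, k ≤ E ∧ E ≠ ⊤ ∧ a * E ≤ c * E + b) : a ≤ c := by
  by_contra! hca
  obtain ⟨k, hk⟩ := ENNReal.exists_nat_mul_gt (tsub_pos_of_lt hca).ne' hb
  obtain ⟨E, hkE, hE, hle⟩ := h k
  refine hk.not_ge ?_
  calc k * (a - c) ≤ E * (a - c) := by gcongr
    _ = a * E - c * E := by rw [mul_comm, ENNReal.sub_mul fun _ _ => hE]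
    _ ≤ b := tsub_le_iff_left.2 hle

theorem ofReal_minReturns_le_two_mul (hp : 0 < (p : ℝ)) (hv : v ≠ 0)
    (h : expectedHittingTime p x v < ⊤) (τ : ℕ) {D : ℝ≥0∞} {e : ℕ → ℝ≥0∞} (he : ∑' n, e n ≠ ⊤)
    (hD : ∀ (n : ℕ) (y : Instructions) (w : ℤ × ℤ), n * law p y {ω | walk n ω = w} ≤ D + e n) :
    ENNReal.ofReal (minReturns τ p) ≤ 2 * D := by
  set R := ENNReal.ofReal (minReturns τ p)
  have hb : R * τ + 2 * ∑' n, e n ≠ ⊤ := by finiteness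
  refine le_of_forall_exists_mul_le_mul_add hb fun k => ?_
  obtain ⟨y, w, hk, hfin⟩ := exists_natCast_le_expectedHittingTime_lt_top hp hv h k
  refine ⟨expectedHittingTime p y w, hk, hfin.ne, ?_⟩
  calc R * expectedHittingTime p y w
      ≤ R * τ + ∑' t : ℕ, t * law p y (lateVisit w t) :=
        mul_expectedHittingTime_le hfin.ne τ fun z => ofReal_minReturns_le p z τ
    _ ≤ R * τ + 2 * (D * expectedHittingTime p y w + ∑' n, e n) := by
        gcongr
        exact tsum_mul_law_lateVisit_le y w hD
    _ = 2 * D * expectedHittingTime p y w + (R * τ + 2 * ∑' n, e n) := by ring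

theorem minReturns_le_two_mul_heatConst (hp : 0 < (p : ℝ)) (hv : v ≠ 0)
    (h : expectedHittingTime p x v < ⊤) (τ : ℕ) : minReturns τ p ≤ 2 * heatConst p := by
  have hheat : 0 ≤ heatConst p := heatConst_nonneg p
  by_contra! hlt
  have hR : 0 < minReturns τ p := by linarith
  obtain ⟨κ, hκ, hκ₁⟩ := exists_between ((div_lt_one hR).2 hlt)
  have hκ₀ : 0 < κ := (by positivity : 0 ≤ 2 * heatConst p / minReturns τ p).trans_lt hκ
  obtain ⟨e, he, hD⟩ := exists_nat_mul_law_walk_eq_le hp ⟨hκ₀, hκ₁⟩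
  have hle := ofReal_minReturns_le_two_mul hp hv h τ he hD
  rw [← ENNReal.ofReal_ofNat 2, ← ENNReal.ofReal_mul zero_le_two,
    ENNReal.ofReal_le_ofReal_iff (by positivity), ← mul_div_assoc, le_div_iff₀ hκ₀] at hle
  rw [div_lt_iff₀ hR] at hκ
  linarith

end MinReturns

end GuidedWalk

theorem mainTheorem4 (p : unitInterval) (hp : 0 < (p : ℝ)) (home : ℤ × ℤ) (hhome : home ≠ 0)
    (hfin : ∃ x : GuidedWalk.Instructions, GuidedWalk.expectedHittingTime p x home < ⊤)
    (τ : ℕ) (hτ : 0 < τ) :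
    1 ≤ 4 / (Real.pi * (p : ℝ) * Real.sqrt (3 - 2 * (p : ℝ)) * GuidedWalk.minReturns τ p) := by
  obtain ⟨x, hx⟩ := hfin
  have : Nonempty GuidedWalk.Instructions := ⟨x⟩
  have hR : 1 ≤ GuidedWalk.minReturns τ p := GuidedWalk.one_le_minReturns τ p
  have hsqrt : 0 < Real.sqrt (3 - 2 * (p : ℝ)) :=
    Real.sqrt_pos.2 (GuidedWalk.three_sub_two_mul_pos p)
  have hle : GuidedWalk.minReturns τ p ≤ 2 * (2 / (Real.pi * p * Real.sqrt (3 - 2 * (p : ℝ)))) :=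
    GuidedWalk.minReturns_le_two_mul_heatConst hp hhome hx τ
  rw [← mul_div_assoc, le_div_iff₀ (by positivity)] at hle
  rw [one_le_div (by positivity)]
  linarith
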